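/- **Setting.** Let $1\le p<n$ and $1\le i\le n-p$ be integers. Let $F_1,\dots,F_p\in\mathbb{Q}[X_1,\dots,X_n]$ be a regular sequence generating a radical ideal. Let $S=\{F_1=\dots=F_p=0\}\subset\mathbb{C}^n$, and let $S_{\mathbb{R}}=S\cap\mathbb{R}^n$. Let $J(F)=[\partial F_k/\partial X_l]$ be the Jacobian matrix. A point of $S$ is called regular if $J(F)$ has rank $p$ there. For a complex $((n-p-i+1)\times n)$-matrix $a=[a_{k,l}]$, write $\overline a$ for the matrix obtained from $a$ by putting a column of ones in front. The dual polar variety $W_{\overline K(\overline a)}(S)$ is the Zariski closure in $\mathbb{C}^n$ of the set of regular points $x$ of $S$ at which all $(n-i+1)$-minors of the $((n-i+1)\times n)$-matrix $$\begin{bmatrix} & J(F)(x) & \\ a_{1,1}-x_1&\cdots&a_{1,n}-x_n\\ \vdots&&\vdots\\ a_{n-p-i+1,1}-x_1&\cdots&a_{n-p-i+1,n}-x_n\end{bmatrix}$$ vanish. If $a$ is real, put $W_{\overline K(\overline a)}(S_{\mathbb{R}})=W_{\overline K(\overline a)}(S)\cap\mathbb{R}^n$. Genericity is understood relative to an arbitrary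 prescribed genericity condition, that is, a non-empty Zariski-open set $U\subset\mathbb{C}^{(n-p-i+1)\times n}$. The polar variety $W_{\overline K(\overline a)}(S_{\mathbb{R}})$ is called generic (with respect to $U$) if $a\in U$. **Theorem.** Let $C$ be a connected component of $S_{\mathbb{R}}$ (in the Euclidean topology) containing a regular point of $S$. Then for every genericity condition $U$ there is a non-empty set $O$ of real $((n-p-i+1)\times n)$-matrices, open in the Euclidean topology, such that every $a\in O$ has maximal rank $n-p-i+1$, the real dual polar variety $W_{\overline K(\overline a)}(S_{\mathbb{R}})$ is generic with respect to $U$ (that is, $a\in U$), and $W_{\overline K(\overline a)}(S_{\mathbb{R}})$ contains a regular point of $C$. -/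

import Mathlib

open MvPolynomial

noncomputable section

/-- The affine variety `S = {F₁ = 0, …, F_p = 0}` in complex affine `n`-space. -/
def complexVariety {n p : ℕ} (F : Fin p → MvPolynomial (Fin n) ℚ) : Set (Fin n → ℂ) :=
  {x | ∀ k, aeval x (F k) = 0}

/-- The Jacobian `J(F₁, …, F_p) = [∂F_k/∂X_l]`, evaluated at a complex point. -/
def jacobianAt {n p : ℕ} (F : Fin p → MvPolynomial (Fin n) ℚ) (x : Fin n → ℂ) :
    Matrix (Fin p) (Fin n) ℂ :=
  Matrix.of fun k l => aeval x (pderiv l (F k))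

/-- The regular points of `S`: the points of `S` where the Jacobian has rank `p`. -/
def regularLocus {n p : ℕ} (F : Fin p → MvPolynomial (Fin n) ℚ) : Set (Fin n → ℂ) :=
  {x | x ∈ complexVariety F ∧ (jacobianAt F x).rank = p}

/-- The real trace `Y ∩ ℝⁿ` of a subset `Y` of `ℂⁿ`. -/
def realTrace {n : ℕ} (Y : Set (Fin n → ℂ)) : Set (Fin n → ℝ) :=
  {x | (fun l => (x l : ℂ)) ∈ Y}

/-- The Zariski closure in `ℂⁿ`. -/
def zariskiClosure {n : ℕ} (Y : Set (Fin n → ℂ)) : Set (Fin n → ℂ) :=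
  zeroLocus ℂ (vanishingIdeal ℂ Y)

/-- For a matrix `α` with columns `0, …, n`, the matrix obtained by stacking the Jacobian at `x` on
top of the rows `(α_{k,1} - α_{k,0} x₁, …, α_{k,n} - α_{k,0} x_n)`. -/
def dualPolarMatrix {n p r : ℕ} (F : Fin p → MvPolynomial (Fin n) ℚ)
    (α : Matrix (Fin r) (Fin (n + 1)) ℂ) (x : Fin n → ℂ) :
    Matrix (Fin p ⊕ Fin r) (Fin n) ℂ :=
  Matrix.fromRows (jacobianAt F x) (Matrix.of fun k l => α k l.succ - α k 0 * x l)

/-- The dual polar variety of `S` associated with `α`: the Zariski closure of the locus of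
regular points of `S` where all maximal minors (of size `p + r`) of `dualPolarMatrix F α` vanish. -/
def dualPolarVariety {n p r : ℕ} (F : Fin p → MvPolynomial (Fin n) ℚ)
    (α : Matrix (Fin r) (Fin (n + 1)) ℂ) : Set (Fin n → ℂ) :=
  zariskiClosure {x | x ∈ regularLocus F ∧
    ∀ c : (Fin p ⊕ Fin r) ↪ Fin n, ((dualPolarMatrix F α x).submatrix id c).det = 0}

/-- A complex matrix `a` with a column of ones, of index `0`, put in front. -/
def prependOnes {n r : ℕ} (a : Matrix (Fin r) (Fin n) ℂ) : Matrix (Fin r) (Fin (n + 1)) ℂ :=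
  Matrix.of fun k => Fin.cons 1 (a k)

/-- Zariski open subsets of the affine space of complex `r × n` matrices: complements of the set
of common zeros of a family of polynomials in the entries. -/
def IsZariskiOpenMatrix {n r : ℕ} (U : Set (Matrix (Fin r) (Fin n) ℂ)) : Prop :=
  ∃ T : Set (MvPolynomial (Fin r × Fin n) ℂ),
    U = {a | ∃ f ∈ T, aeval (fun kl : Fin r × Fin n => a kl.1 kl.2) f ≠ 0}

/-- `C` is a connected component of the subset `Y` of a topological space. -/
def IsConnectedComponentOf {X : Type*} [TopologicalSpace X] (C Y : Set X) : Prop :=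
  ∃ x ∈ Y, C = connectedComponentIn Y x

end

/-! Let `z` be a regular point of `C` and `b` a real point close to `z`. The squared distance to `b`
attains its minimum over `C` intersected with a small closed ball around `z`. The minimiser `x` lies
inside the ball and is regular, since regularity is an open condition
(`exists_regular_isLocalMinOn`). Near `x` the component is all of `S_ℝ`, so Lagrange multipliers
give a nontrivial relation between the rows of `J(F)(x)` and `b - x`
(`exists_multipliers_of_isLocalMinOn_component`). If `b` is a row of `a`, all maximal minors
therefore vanish at `x`, whatever the other rows are.

Hence only the first row of `a` has to be near `z`. Full rank and membership in `U` follow from the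
non-vanishing of two nonzero polynomials, which is possible at a real point of any nonempty open set
(`exists_real_eval_ne_zero`). -/

/-- Polynomial functions are strictly differentiable, with differential given by `pderiv`. -/
theorem hasStrictFDerivAt_aeval {R σ : Type*} [CommSemiring R] [Algebra R ℝ] [Fintype σ]
    (f : MvPolynomial σ R) (x : σ → ℝ) :
    HasStrictFDerivAt (fun y : σ → ℝ => aeval y f)
      (∑ l, aeval x (pderiv l f) • ContinuousLinearMap.proj (R := ℝ) (φ := fun _ : σ => ℝ) l) x := by
  classical
  induction f using MvPolynomial.induction_on with
  | C r => simpa using hasStrictFDerivAt_const (𝕜 := ℝ) (algebraMap R ℝ r) x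
  | add f g hf hg =>
    simp only [map_add, add_smul, Finset.sum_add_distrib]
    exact hf.add hg
  | mul_X f l hf =>
    have h := hf.mul (hasStrictFDerivAt_apply (𝕜 := ℝ) (F' := fun _ : σ => ℝ) l x)
    simp only [map_mul, aeval_X]
    refine h.congr_fderiv ?_
    ext v
    simp [Derivation.leibniz, pderiv_X, Pi.single_apply, add_mul, Finset.sum_add_distrib,
      Finset.mul_sum, apply_ite, ite_mul, mul_assoc]

/-! ### Rank and Gram determinants -/

theorem rank_eq_card_iff_det_ne_zero {m K : Type*} [Fintype m] [DecidableEq m] [Field K]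
    (A : Matrix m m K) : A.rank = Fintype.card m ↔ A.det ≠ 0 := by
  refine ⟨fun h => ?_, Matrix.rank_of_det_ne_zero⟩
  have h1 : LinearMap.range A.mulVecLin = ⊤ := by
    apply Submodule.eq_top_of_finrank_eq
    rw [Module.finrank_fintype_fun_eq_card]
    exact h
  rw [← isUnit_iff_ne_zero, ← Matrix.isUnit_iff_isUnit_det, ← Matrix.mulVec_surjective_iff_isUnit]
  exact LinearMap.range_eq_top.1 h1

theorem rank_eq_card_iff_gram_ne_zero {m k : Type*} [Fintype m] [DecidableEq m] [Fintype k]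
    (A : Matrix m k ℝ) : A.rank = Fintype.card m ↔ (A * A.transpose).det ≠ 0 := by
  rw [← rank_eq_card_iff_det_ne_zero, Matrix.rank_self_mul_transpose]

open ComplexOrder in
-- For real `A`, the product of its complexification with the conjugate transpose is the
-- complexification of `A * Aᵀ`. Complex regularity at real points thus becomes the non-vanishing of
-- a real continuous function.
theorem rank_map_ofReal_eq_card_iff {m k : Type*} [Fintype m] [DecidableEq m] [Fintype k]
    (A : Matrix m k ℝ) :
    (A.map Complex.ofReal).rank = Fintype.card m ↔ (A * A.transpose).det ≠ 0 := by
  have h : A.map Complex.ofReal * (A.map Complex.ofReal).conjTranspose =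
      Complex.ofRealHom.mapMatrix (A * A.transpose) := by
    ext i j
    simp [Matrix.mul_apply]
  rw [← Matrix.rank_self_mul_conjTranspose, rank_eq_card_iff_det_ne_zero, h, ← RingHom.map_det]
  simp

theorem det_eq_zero_of_rows_dependent {m k : Type*} [Fintype m] [DecidableEq m]
    (M : Matrix m k ℂ) {w : m → ℂ} (hw : w ≠ 0) (h : ∀ l, ∑ i, w i * M i l = 0) (c : m → k) :
    (M.submatrix id c).det = 0 := by
  rw [← Matrix.exists_vecMul_eq_zero_iff]
  exact ⟨w, hw, funext fun j => by simpa [Matrix.vecMul, dotProduct] using h (c j)⟩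

/-! ### Connected components and real points -/

/-- Near a point where `f` is a submersion, the fibre of `f` is contained in the connected component
of that point. -/
theorem eventually_mem_connectedComponentIn_fiber {E F : Type*} [NormedAddCommGroup E]
    [NormedSpace ℝ E] [CompleteSpace E] [NormedAddCommGroup F] [NormedSpace ℝ F]
    [FiniteDimensional ℝ F] {f : E → F} {f' : E →L[ℝ] F} {x : E}
    (hf : HasStrictFDerivAt f f' x) (hf' : f'.range = ⊤) :
    ∀ᶠ y in nhdsWithin x {y | f y = f x}, y ∈ connectedComponentIn {y | f y = f x} x := by
  -- The first coordinate of this chart is `f`, so the fibre becomes a slice parametrised by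
  -- `f'.ker`; a ball there is connected and gives the connected piece `K` of the fibre.
  set φ := hf.implicitToOpenPartialHomeomorph f f' hf' with hφ
  have hx : x ∈ φ.source := hf.mem_implicitToOpenPartialHomeomorph_source hf'
  have hφx : φ x = (f x, 0) := hf.implicitToOpenPartialHomeomorph_self hf'
  have hfst : ∀ y, (φ y).1 = f y := fun y => hf.implicitToOpenPartialHomeomorph_fst hf' y
  have htgt : φ.target ∈ nhds (f x, (0 : f'.ker)) :=
    φ.open_target.mem_nhds (hφx ▸ φ.map_source hx)
  obtain ⟨ε, hε, hball⟩ := Metric.mem_nhds_iff.1 htgt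
  have hsub : ∀ v ∈ Metric.ball (0 : f'.ker) ε, (f x, v) ∈ φ.target := fun v hv =>
    hball (by simpa [Prod.dist_eq, hε] using hv)
  set K : Set E := (fun v : f'.ker => φ.symm (f x, v)) '' Metric.ball 0 ε
  have hK : IsPreconnected K := by
    refine (convex_ball (0 : f'.ker) ε).isPreconnected.image _ ?_
    exact φ.continuousOn_symm.comp (by fun_prop) hsub
  have hKS : K ⊆ {y | f y = f x} := by
    rintro _ ⟨v, hv, rfl⟩
    change f (φ.symm (f x, v)) = f x
    rw [← hfst, φ.right_inv (hsub v hv)]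
  have hxK : x ∈ K := ⟨0, Metric.mem_ball_self hε, by
    change φ.symm (f x, 0) = x
    rw [← hφx, φ.left_inv hx]⟩
  have hcont : ContinuousAt (fun y => (φ y).2) x := (φ.continuousAt hx).snd
  have h2 : ∀ᶠ y in nhds x, (φ y).2 ∈ Metric.ball (0 : f'.ker) ε :=
    hcont.eventually_mem (Metric.isOpen_ball.mem_nhds (by simpa [hφx] using hε))
  have h1 : ∀ᶠ y in nhds x, y ∈ φ.source := φ.open_source.mem_nhds hx
  rw [eventually_nhdsWithin_iff]
  filter_upwards [h1, h2] with y hy1 hy2 hy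
  refine hK.subset_connectedComponentIn hxK hKS ⟨(φ y).2, hy2, ?_⟩
  change φ.symm (f x, (φ y).2) = y
  have hyx : f y = f x := hy
  rw [← hyx, ← hfst y, Prod.mk.eta, φ.left_inv hy1]

/-- The closure of a component is preconnected and stays in the closed set `S`, so maximality
applies. -/
theorem isClosed_connectedComponentIn {X : Type*} [TopologicalSpace X] {S : Set X}
    (hS : IsClosed S) (x : X) : IsClosed (connectedComponentIn S x) := by
  by_cases hx : x ∈ S
  · refine isClosed_of_closure_subset ?_
    exact isPreconnected_connectedComponentIn.closure.subset_connectedComponentIn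
      (subset_closure (mem_connectedComponentIn hx))
      (closure_minimal (connectedComponentIn_subset S x) hS)
  · simp [connectedComponentIn_eq_empty hx]

/-- A nonzero complex polynomial has a nonzero value at some real point of any open set. -/
theorem exists_real_eval_ne_zero {σ : Type*} [Finite σ] {f : MvPolynomial σ ℂ} (hf : f ≠ 0)
    {V : Set (σ → ℝ)} (hV : IsOpen V) {v : σ → ℝ} (hv : v ∈ V) :
    ∃ x ∈ V, aeval (fun s => (x s : ℂ)) f ≠ 0 := by
  have := Fintype.ofFinite σ
  obtain ⟨ε, hε, hball⟩ := Metric.isOpen_iff.1 hV v hv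
  by_contra! h
  -- A sup-metric ball is a product of intervals, and a polynomial vanishing on a product of
  -- infinite sets is zero.
  refine hf (funext_set (fun s => Complex.ofReal '' Metric.ball (v s) ε) (fun s => ?_) fun y hy => ?_)
  · refine Set.Infinite.image Complex.ofReal_injective.injOn ?_
    rw [Real.ball_eq_Ioo]
    exact Set.Ioo_infinite (by linarith)
  · choose x hx hxy using fun s => hy s (Set.mem_univ s)
    obtain rfl : (fun s => (x s : ℂ)) = y := funext hxy
    rw [map_zero, ← h x (hball ?_), aeval_eq_eval]
    rw [ball_pi v hε]
    exact fun s _ => hx s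

/-- The Jacobian at a real point, as a real matrix. -/
noncomputable def realJacobian {n p : ℕ} (F : Fin p → MvPolynomial (Fin n) ℚ) (x : Fin n → ℝ) :
    Matrix (Fin p) (Fin n) ℝ :=
  Matrix.of fun k l => aeval x (pderiv l (F k))

theorem aeval_ofReal {σ : Type*} (f : MvPolynomial σ ℚ) (x : σ → ℝ) :
    aeval (fun l => (x l : ℂ)) f = ((aeval x f : ℝ) : ℂ) :=
  aeval_algebraMap_apply ℂ x f

theorem jacobianAt_ofReal {n p : ℕ} (F : Fin p → MvPolynomial (Fin n) ℚ) (x : Fin n → ℝ) :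
    jacobianAt F (fun l => (x l : ℂ)) = (realJacobian F x).map Complex.ofReal := by
  ext k l
  simp [jacobianAt, realJacobian, aeval_ofReal]

theorem mem_realTrace_complexVariety {n p : ℕ} {F : Fin p → MvPolynomial (Fin n) ℚ}
    {x : Fin n → ℝ} : x ∈ realTrace (complexVariety F) ↔ ∀ k, aeval x (F k) = (0 : ℝ) := by
  simp [realTrace, complexVariety, aeval_ofReal]

theorem mem_realTrace_regularLocus {n p : ℕ} {F : Fin p → MvPolynomial (Fin n) ℚ}
    {x : Fin n → ℝ} : x ∈ realTrace (regularLocus F) ↔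
      x ∈ realTrace (complexVariety F) ∧
        (realJacobian F x * (realJacobian F x).transpose).det ≠ 0 := by
  have h := rank_map_ofReal_eq_card_iff (realJacobian F x)
  rw [Fintype.card_fin] at h
  rw [← h, ← jacobianAt_ofReal]
  rfl

theorem continuous_aeval_real {σ : Type*} [Fintype σ] (f : MvPolynomial σ ℚ) :
    Continuous fun y : σ → ℝ => (aeval y f : ℝ) :=
  continuous_iff_continuousAt.2 fun x => (hasStrictFDerivAt_aeval f x).continuousAt

theorem isClosed_realTrace_complexVariety {n p : ℕ} (F : Fin p → MvPolynomial (Fin n) ℚ) :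
    IsClosed (realTrace (complexVariety F)) := by
  have : realTrace (complexVariety F) = ⋂ k, {x : Fin n → ℝ | aeval x (F k) = (0 : ℝ)} := by
    ext x
    simp [mem_realTrace_complexVariety]
  rw [this]
  exact isClosed_iInter fun k => isClosed_eq (continuous_aeval_real _) continuous_const

theorem continuous_gram_realJacobian {n p : ℕ} (F : Fin p → MvPolynomial (Fin n) ℚ) :
    Continuous fun x => (realJacobian F x * (realJacobian F x).transpose).det := by
  have h : Continuous (realJacobian F) :=
    continuous_matrix fun k l => continuous_aeval_real (pderiv l (F k))
  exact (h.matrix_mul h.matrix_transpose).matrix_det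

/-- At a regular point the differential of `F` is onto. -/
theorem range_pi_eq_top_of_gram_ne_zero {n p : ℕ} {A : Matrix (Fin p) (Fin n) ℝ}
    (h : (A * A.transpose).det ≠ 0) :
    (ContinuousLinearMap.pi fun k : Fin p => ∑ l, A k l •
      ContinuousLinearMap.proj (R := ℝ) (φ := fun _ : Fin n => ℝ) l).range = ⊤ := by
  have hA : LinearMap.range A.mulVecLin = ⊤ := by
    apply Submodule.eq_top_of_finrank_eq
    rw [Module.finrank_fintype_fun_eq_card]
    exact (rank_eq_card_iff_gram_ne_zero A).2 h
  rw [← hA]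
  congr 1
  ext v k
  simp [Matrix.mulVec, dotProduct]

/-! ### Critical points of the distance function -/

/-- A regular point of the component which locally minimises the squared distance to `b` on the
component satisfies the Lagrange condition. -/
theorem exists_multipliers_of_isLocalMinOn_component {n p : ℕ}
    {F : Fin p → MvPolynomial (Fin n) ℚ} {x b : Fin n → ℝ}
    (hx : x ∈ realTrace (regularLocus F))
    (hmin : IsLocalMinOn (fun y : Fin n → ℝ => ∑ l, (y l - b l) ^ 2)
      (connectedComponentIn (realTrace (complexVariety F)) x) x) :
    ∃ (Λ : Fin p → ℝ) (μ : ℝ), (Λ, μ) ≠ 0 ∧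
      ∀ l, ∑ k, Λ k * realJacobian F x k l + μ * (b l - x l) = 0 := by
  classical
  obtain ⟨hxS, hdet⟩ := mem_realTrace_regularLocus.1 hx
  rw [mem_realTrace_complexVariety] at hxS
  have hF : ∀ k, HasStrictFDerivAt (fun y : Fin n → ℝ => (aeval y (F k) : ℝ))
      (∑ l, realJacobian F x k l • ContinuousLinearMap.proj (R := ℝ) (φ := fun _ : Fin n => ℝ) l)
      x := fun k => hasStrictFDerivAt_aeval (F k) x
  have hS : realTrace (complexVariety F) =
      {y | (fun k => (aeval y (F k) : ℝ)) = fun k => aeval x (F k)} := by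
    ext y
    simp [mem_realTrace_complexVariety, hxS, funext_iff]
  have hev := eventually_mem_connectedComponentIn_fiber (hasStrictFDerivAt_pi.2 hF)
    (range_pi_eq_top_of_gram_ne_zero hdet)
  rw [← hS] at hev
  have hmin' : IsLocalMinOn (fun y : Fin n → ℝ => ∑ l, (y l - b l) ^ 2)
      {y | ∀ k, (aeval y (F k) : ℝ) = aeval x (F k)} x := by
    have hS' : {y : Fin n → ℝ | ∀ k, (aeval y (F k) : ℝ) = aeval x (F k)} =
        realTrace (complexVariety F) := by
      rw [hS]; ext y; simp [funext_iff]
    rw [hS']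
    exact Filter.Eventually.filter_mono (nhdsWithin_le_iff.2 hev) hmin
  have hdist : HasStrictFDerivAt (fun y : Fin n → ℝ => ∑ l, (y l - b l) ^ 2)
      (∑ l, (2 * (x l - b l)) • ContinuousLinearMap.proj (R := ℝ) (φ := fun _ : Fin n => ℝ) l)
      x := by
    refine HasStrictFDerivAt.fun_sum fun l _ => ?_
    have := ((hasStrictFDerivAt_apply (𝕜 := ℝ) (F' := fun _ : Fin n => ℝ) l x).sub_const
      (b l)).pow 2
    refine this.congr_fderiv ?_
    ext v
    simp
  obtain ⟨Λ, μ, hne, hsum⟩ :=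
    IsLocalExtrOn.exists_multipliers_of_hasStrictFDerivAt (Or.inl hmin') hF hdist
  -- The differential of the squared distance is `2 (x - b)`, whereas the relation is stated with `b
  -- - x`.
  refine ⟨Λ, -2 * μ, ?_, fun l => ?_⟩
  · simpa [Prod.ext_iff] using hne
  · have := DFunLike.congr_fun hsum (Pi.single l 1)
    simp [Pi.single_apply] at this
    linarith

theorem subset_zariskiClosure {n : ℕ} (Y : Set (Fin n → ℂ)) : Y ⊆ zariskiClosure Y :=
  fun _ hx _ hf => hf _ hx

/-- A nontrivial dependence between the Jacobian and one of the rows `a_k - x` puts the regular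
point `x` on the dual polar variety. -/
theorem mem_dualPolarVariety_of_multipliers {n p r : ℕ} {F : Fin p → MvPolynomial (Fin n) ℚ}
    {x : Fin n → ℝ} (hx : x ∈ realTrace (regularLocus F)) (a : Matrix (Fin r) (Fin n) ℝ)
    (k₀ : Fin r) {Λ : Fin p → ℝ} {μ : ℝ} (hne : (Λ, μ) ≠ 0)
    (h : ∀ l, ∑ k, Λ k * realJacobian F x k l + μ * (a k₀ l - x l) = 0) :
    x ∈ realTrace (dualPolarVariety F (prependOnes (a.map Complex.ofReal))) := by
  refine subset_zariskiClosure _ ⟨hx, fun c => ?_⟩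
  refine det_eq_zero_of_rows_dependent _
    (w := Sum.elim (fun k => (Λ k : ℂ)) (Pi.single k₀ (μ : ℂ))) (fun h0 => hne ?_) (fun l => ?_) c
  · have h1 : ∀ k, Λ k = 0 := fun k => by simpa using congrFun h0 (Sum.inl k)
    have h2 : μ = 0 := by simpa using congrFun h0 (Sum.inr k₀)
    simp [Prod.ext_iff, funext_iff, h1, h2]
  · have := congrArg Complex.ofReal (h l)
    push_cast at this
    simpa [dualPolarMatrix, prependOnes, jacobianAt_ofReal, Pi.single_apply] using this

/-- If `b` is close enough to a regular point `z`, the squared distance to `b` has a local minimum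
on the component of `z` at some regular point. -/
theorem exists_regular_isLocalMinOn {n p : ℕ} {F : Fin p → MvPolynomial (Fin n) ℚ}
    {z : Fin n → ℝ} (hz : z ∈ realTrace (regularLocus F)) :
    ∃ ε > 0, ∀ b : Fin n → ℝ, ∑ l, (z l - b l) ^ 2 < ε →
      ∃ x ∈ connectedComponentIn (realTrace (complexVariety F)) z,
        x ∈ realTrace (regularLocus F) ∧
        IsLocalMinOn (fun y : Fin n → ℝ => ∑ l, (y l - b l) ^ 2)
          (connectedComponentIn (realTrace (complexVariety F)) z) x := by
  obtain ⟨hzS, hdet⟩ := mem_realTrace_regularLocus.1 hz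
  set C := connectedComponentIn (realTrace (complexVariety F)) z
  have hzC : z ∈ C := mem_connectedComponentIn hzS
  obtain ⟨δ, hδ, hball⟩ := Metric.isOpen_iff.1
    (isOpen_ne_fun (continuous_gram_realJacobian F) continuous_const) z hdet
  -- Both `z` and the minimiser are then within `δ / 2` of `b` in each coordinate, so the minimiser
  -- is in the open `δ`-ball around `z`.
  refine ⟨(δ / 2) ^ 2, by positivity, fun b hb => ?_⟩
  have hK : IsCompact (C ∩ Metric.closedBall z δ) :=
    (isCompact_closedBall z δ).inter_left
      (isClosed_connectedComponentIn (isClosed_realTrace_complexVariety F) z)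
  have hcont : Continuous fun y : Fin n → ℝ => ∑ l, (y l - b l) ^ 2 := by fun_prop
  obtain ⟨x, ⟨hxC, -⟩, hxmin⟩ := hK.exists_isMinOn
    ⟨z, hzC, Metric.mem_closedBall_self hδ.le⟩ hcont.continuousOn
  have hxz : ∑ l, (x l - b l) ^ 2 ≤ ∑ l, (z l - b l) ^ 2 :=
    hxmin ⟨hzC, Metric.mem_closedBall_self hδ.le⟩
  have hcoord : ∀ y : Fin n → ℝ, ∑ l, (y l - b l) ^ 2 < (δ / 2) ^ 2 → ∀ l, |y l - b l| < δ / 2 :=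
    fun y hy l => abs_lt_of_sq_lt_sq ((Finset.single_le_sum
      (f := fun l => (y l - b l) ^ 2) (fun i _ => sq_nonneg _) (Finset.mem_univ l)).trans_lt hy)
      (by positivity)
  have hxball : x ∈ Metric.ball z δ := by
    rw [Metric.mem_ball, dist_pi_lt_iff hδ]
    intro l
    have h1 := abs_lt.1 (hcoord x (hxz.trans_lt hb) l)
    have h2 := abs_lt.1 (hcoord z hb l)
    rw [Real.dist_eq, abs_lt]
    constructor <;> linarith
  refine ⟨x, hxC, mem_realTrace_regularLocus.2
    ⟨connectedComponentIn_subset _ _ hxC, hball hxball⟩, ?_⟩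
  have : C ∩ Metric.closedBall z δ ∈ nhdsWithin x C :=
    Filter.inter_mem self_mem_nhdsWithin (mem_nhdsWithin_of_mem_nhds
      (Filter.mem_of_superset (Metric.isOpen_ball.mem_nhds hxball) Metric.ball_subset_closedBall))
  exact Filter.mem_of_superset this hxmin

/-! ### Genericity and conclusion -/

/-- The Gram determinant of the generic `r × n` matrix, as a polynomial in the entries. -/
noncomputable def gramPolynomial (r n : ℕ) : MvPolynomial (Fin r × Fin n) ℂ :=
  (Matrix.mvPolynomialX (Fin r) (Fin n) ℂ *
    (Matrix.mvPolynomialX (Fin r) (Fin n) ℂ).transpose).det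

theorem aeval_gramPolynomial {r n : ℕ} (v : Fin r × Fin n → ℂ) :
    aeval v (gramPolynomial r n) =
      (Matrix.of (fun k l => v (k, l)) *
        (Matrix.of fun k l => v (k, l) : Matrix (Fin r) (Fin n) ℂ).transpose).det := by
  rw [gramPolynomial, AlgHom.map_det]
  congr 1
  ext i j
  simp [Matrix.mul_apply]

theorem gramPolynomial_ne_zero {r n : ℕ} (h : r ≤ n) : gramPolynomial r n ≠ 0 := by
  intro h0
  -- The first `r` rows of the identity matrix have Gram matrix `1`.
  have := aeval_gramPolynomial (r := r) (n := n)
    fun kl => (1 : Matrix (Fin n) (Fin n) ℂ) (Fin.castLE h kl.1) kl.2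
  rw [h0, map_zero] at this
  refine one_ne_zero (α := ℂ) (Eq.trans ?_ this.symm)
  rw [← Matrix.det_one (n := Fin r)]
  congr 1
  ext i j
  simp [Matrix.mul_apply, Matrix.one_apply, (Fin.castLE_injective h).eq_iff, eq_comm]

theorem theorem2p2 {n p i : ℕ} (hp : 1 ≤ p) (hi : 1 ≤ i) (hin : i ≤ n - p)
    (F : Fin p → MvPolynomial (Fin n) ℚ)
    (hreg : RingTheory.Sequence.IsRegular (MvPolynomial (Fin n) ℚ) (List.ofFn F))
    (hrad : (Ideal.span (Set.range F)).IsRadical)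
    (C : Set (Fin n → ℝ))
    (hC : IsConnectedComponentOf C (realTrace (complexVariety F)))
    (hCreg : ∃ z ∈ C, z ∈ realTrace (regularLocus F))
    (U : Set (Matrix (Fin (n - p - i + 1)) (Fin n) ℂ))
    (hUopen : IsZariskiOpenMatrix U) (hUne : U.Nonempty) :
    ∃ O : Set (Matrix (Fin (n - p - i + 1)) (Fin n) ℝ),
      O.Nonempty ∧ IsOpen O ∧
      ∀ a ∈ O, a.rank = n - p - i + 1 ∧
        a.map Complex.ofReal ∈ U ∧
        ∃ x ∈ C, x ∈ realTrace (regularLocus F) ∧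
          x ∈ realTrace (dualPolarVariety F (prependOnes (a.map Complex.ofReal))) := by
  obtain ⟨z, hzC, hz⟩ := hCreg
  obtain ⟨y, -, rfl⟩ := hC
  rw [connectedComponentIn_eq hzC]
  obtain ⟨ε, hε, hmin⟩ := exists_regular_isLocalMinOn hz
  obtain ⟨T, rfl⟩ := hUopen
  obtain ⟨u, f, hfT, hfu⟩ := hUne
  have hf0 : f ≠ 0 := by
    rintro rfl
    simp at hfu
  have hr : n - p - i + 1 ≤ n := by omega
  generalize hrdef : n - p - i = s at *
  have hcpoly : Continuous fun a : Matrix (Fin (s + 1)) (Fin n) ℝ =>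
      aeval (fun kl : Fin (s + 1) × Fin n => (a kl.1 kl.2 : ℂ)) f := by
    simp only [aeval_eq_eval]
    exact (continuous_eval f).comp (continuous_pi fun kl =>
      Complex.continuous_ofReal.comp (continuous_apply_apply kl.1 kl.2))
  have hcgram : Continuous fun a : Matrix (Fin (s + 1)) (Fin n) ℝ => (a * a.transpose).det :=
    (continuous_id.matrix_mul continuous_id.matrix_transpose).matrix_det
  have hcdist : Continuous fun a : Matrix (Fin (s + 1)) (Fin n) ℝ =>
      ∑ l, (z l - a 0 l) ^ 2 :=
    continuous_finsetSum _ fun l _ => (continuous_const.sub (continuous_apply_apply 0 l)).pow 2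
  refine ⟨{a | ∑ l, (z l - a 0 l) ^ 2 < ε} ∩ ({a | (a * a.transpose).det ≠ 0} ∩
      {a | aeval (fun kl : Fin (s + 1) × Fin n => (a kl.1 kl.2 : ℂ)) f ≠ 0}), ?_, ?_, ?_⟩
  · have hV : IsOpen {v : Fin (s + 1) × Fin n → ℝ | ∑ l, (z l - v (0, l)) ^ 2 < ε} :=
      isOpen_lt (by fun_prop) continuous_const
    -- The matrix with all rows equal to `z` shows that the open set is nonempty; the product
    -- polynomial handles rank and `U` at once.
    obtain ⟨v, hv, hne⟩ := exists_real_eval_ne_zero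
      (mul_ne_zero (gramPolynomial_ne_zero hr) hf0) hV (v := fun kl => z kl.2) (by simpa using hε)
    rw [map_mul] at hne
    refine ⟨Matrix.of fun k l => v (k, l), hv, fun h0 => left_ne_zero_of_mul hne ?_,
      right_ne_zero_of_mul hne⟩
    have hg := aeval_gramPolynomial fun kl => (v kl : ℂ)
    have hm : Matrix.of (fun k l => (v (k, l) : ℂ)) *
        (Matrix.of fun k l => (v (k, l) : ℂ)).transpose =
        Complex.ofRealHom.mapMatrix ((Matrix.of fun k l => v (k, l)) *
          (Matrix.of fun k l => v (k, l)).transpose) := by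
      ext i j
      simp [Matrix.mul_apply]
    rw [hm, ← RingHom.map_det, h0, map_zero] at hg
    exact hg
  · exact (isOpen_lt hcdist continuous_const).inter
      ((isOpen_ne_fun hcgram continuous_const).inter (isOpen_ne_fun hcpoly continuous_const))
  · rintro a ⟨had, hag, haf⟩
    refine ⟨by simpa using (rank_eq_card_iff_gram_ne_zero a).2 hag, ⟨f, hfT, haf⟩, ?_⟩
    obtain ⟨x, hxC, hx, hxmin⟩ := hmin (a 0) had
    rw [connectedComponentIn_eq hxC] at hxmin
    obtain ⟨Λ, μ, hne, hsum⟩ := exists_multipliers_of_isLocalMinOn_component hx hxmin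
    exact ⟨x, hxC, hx, mem_dualPolarVariety_of_multipliers hx a 0 hne hsum⟩
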